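/- Let $E$ and $F$ be real Banach lattices, $L(E,F)$ the space of bounded linear operators from $E$ to $F$, ordered by $S\le T$ iff $Sx\le Tx$ for all $x\in E_+$, and let $E',F'$ be the dual Banach lattices and $T':F'\to E'$ the adjoint of $T\in L(E,F)$. A sequence $(x_n)$ in a Banach lattice is disjoint if $|x_n|\wedge|x_m|=0$ for $n\ne m$. A bounded set $A\subseteq E$ is limited (resp. almost limited) if every weak$^*$-null (resp. every disjoint weak$^*$-null) sequence in $E'$ converges to $0$ uniformly on $A$. Define the following sets $\mathcal P\subseteq L(E,F)$ by requiring, of $T\in L(E,F)$: - $[\mathrm{PSP}]$: $\|Tx_n\|\to0$ for each weakly null $(x_n)$ in $E_+$; - $[\mathrm{DPSP}]$ (resp. $[\mathrm{DDSP}]$): $\|T'f_n\|\to0$ for each weak$^*$-null $(f_n)$ in $F'_+$ (resp. each disjoint weak$^*$-null $(f_n)$ in $F'$); - $[\mathrm{PGP}]$ (resp. $[\mathrm{DGP}]$): $(T'f_n)$ is weakly null in $E'$ for each weak$^*$-null $(f_n)$ in $F'_+$ (resp. each disjoint weak$^*$-null $(f_n)$ in $F'$); - $[\mathrm{swl}]$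 (resp. $[\mathrm{dswl}]$): $(|Tx_n|)$ is weakly null for each weakly null (resp. each disjoint weakly null) $(x_n)$ in $E$; - $[\mathrm{sw}^*\mathrm{l}]$ (resp. $[\mathrm{d}]$): $(|T'f_n|)$ is weak$^*$-null for each weak$^*$-null (resp. each disjoint weak$^*$-null) $(f_n)$ in $F'$; - $[\mathrm{bi\text{-}sP}]$: $f_n(Tx_n)\to0$ for each weak$^*$-null $(f_n)$ in $F'_+$ and each disjoint weakly null $(x_n)$ in $E$; - $[\mathrm{GPP}]$ (resp. $[\mathrm{s\text{-}GPP}]$): $T(A)$ is relatively norm compact for each limited (resp. each almost limited) $A\subseteq E$; - $[\mathrm{BDP}]$ (resp. $[\mathrm{s\text{-}BDP}]$): $T(A)$ is relatively weakly compact for each limited (resp. each almost limited) $A\subseteq E$. For $\mathcal P\subseteq L(E,F)$ let $\mathrm{r}\text{-}\mathcal P(E,F)=\{T_1-T_2:\ 0\le T_1,T_2\in\mathcal P\}$ be the set of regularly $\mathcal P$-operators, with $$\|T\|_{\mathrm{r}\text{-}\mathcal P}=\inf\{\|S\|:\ \pm T\le S\in\mathcal P\}\qquad(T\in\mathrm{r}\text{-}\mathcal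 P(E,F)).$$ **Theorem.** For each of the fourteen sets $\mathcal P$ above, $\mathrm{r}\text{-}\mathcal P(E,F)$ is a linear subspace of $L(E,F)$, $\|\cdot\|_{\mathrm{r}\text{-}\mathcal P}$ is a norm on it, and $\mathrm{r}\text{-}\mathcal P(E,F)$ is complete under this norm; that is, it is a Banach space under its own enveloping norm. -/

import Mathlib

open Filter Topology

set_option linter.unusedSectionVars false

noncomputable section

/-! ### The Banach lattice dual

A Banach lattice is a complete normed space `E` over `ℝ` with
`[Lattice E] [IsOrderedAddMonoid E] [IsOrderedModule ℝ E] [HasSolidNorm E]`. Its dual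
`StrongDual ℝ E` is ordered by `f ≤ g ↔ ∀ x ≥ 0, f x ≤ g x`. It is shown below that this order
is a lattice order, with the modulus given by the Riesz-Kantorovich formula. -/

namespace BanachLatticeDual

section Construction

variable {E : Type*} [NormedAddCommGroup E] [NormedSpace ℝ E] [Lattice E]
  [IsOrderedAddMonoid E] [HasSolidNorm E]

/-- `f ≤ g` in the dual iff `f x ≤ g x` for every `x ≥ 0`. -/
instance instPartialOrder : PartialOrder (StrongDual ℝ E) where
  le f g := ∀ x : E, 0 ≤ x → f x ≤ g x
  le_refl _ _ _ := le_rfl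
  le_trans _ _ _ h₁ h₂ x hx := (h₁ x hx).trans (h₂ x hx)
  le_antisymm f g h₁ h₂ := by
    ext x
    have key : ∀ y : E, 0 ≤ y → f y = g y := fun y hy => le_antisymm (h₁ y hy) (h₂ y hy)
    rw [← posPart_sub_negPart x, map_sub, map_sub, key _ (posPart_nonneg x),
      key _ (negPart_nonneg x)]

theorem le_def {f g : StrongDual ℝ E} : f ≤ g ↔ ∀ x : E, 0 ≤ x → f x ≤ g x := Iff.rfl

instance instIsOrderedAddMonoid : IsOrderedAddMonoid (StrongDual ℝ E) where
  add_le_add_left f g h k x hx := by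
    simpa using h x hx

/-- The supremum of `f y` over `|y| ≤ x`. -/
def rk (f : StrongDual ℝ E) (x : E) : ℝ := sSup (f '' {y | |y| ≤ x})

theorem rk_bound (f : StrongDual ℝ E) {x y : E} (h : |y| ≤ x) : f y ≤ ‖f‖ * ‖x‖ := by
  have h1 : ‖y‖ ≤ ‖x‖ := norm_le_norm_of_abs_le_abs (h.trans (le_abs_self x))
  calc f y ≤ ‖f y‖ := Real.le_norm_self _
    _ ≤ ‖f‖ * ‖y‖ := f.le_opNorm y
    _ ≤ ‖f‖ * ‖x‖ := by gcongr

theorem le_rk (f : StrongDual ℝ E) {x y : E} (h : |y| ≤ x) : f y ≤ rk f x := by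
  refine le_csSup ⟨‖f‖ * ‖x‖, ?_⟩ ⟨y, h, rfl⟩
  rintro _ ⟨z, hz, rfl⟩
  exact rk_bound f hz

theorem rk_le (f : StrongDual ℝ E) {x : E} (hx : 0 ≤ x) {c : ℝ}
    (h : ∀ y, |y| ≤ x → f y ≤ c) : rk f x ≤ c := by
  refine csSup_le ⟨f 0, 0, by simpa using hx, rfl⟩ ?_
  rintro _ ⟨z, hz, rfl⟩
  exact h z hz

theorem rk_nonneg (f : StrongDual ℝ E) {x : E} (hx : 0 ≤ x) : 0 ≤ rk f x := by
  simpa using le_rk f (y := 0) (x := x) (by simpa using hx)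

theorem rk_add (f : StrongDual ℝ E) {x z : E} (hx : 0 ≤ x) (hz : 0 ≤ z) :
    rk f (x + z) = rk f x + rk f z := by
  apply le_antisymm
  · refine rk_le f (add_nonneg hx hz) fun y hy => ?_
    obtain ⟨hy2, hy1⟩ := abs_le'.1 hy
    have h1 : |(y ⊓ x) ⊔ -x| ≤ x := by
      refine abs_le'.2 ⟨sup_le inf_le_right ((neg_nonpos.2 hx).trans hx), ?_⟩
      exact neg_le.2 le_sup_right
    have h2 : |y - (y ⊓ x) ⊔ -x| ≤ z := by
      refine abs_le'.2 ⟨?_, ?_⟩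
      · have h3 : y - z ≤ y ⊓ x := le_inf (sub_le_self y hz) (sub_le_iff_le_add.2 hy2)
        exact sub_le_comm.1 (h3.trans le_sup_left)
      · rw [neg_sub, sub_le_iff_le_add']
        refine sup_le (inf_le_left.trans (le_add_of_nonneg_right hz)) ?_
        rw [← sub_le_iff_le_add, ← neg_add']
        exact neg_le.1 hy1
    have := add_le_add (le_rk f h1) (le_rk f h2)
    rwa [← map_add, add_sub_cancel] at this
  · rw [← le_sub_iff_add_le]
    refine rk_le f hx fun y hy => ?_
    rw [le_sub_comm]
    refine rk_le f hz fun w hw => ?_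
    rw [le_sub_iff_add_le', ← map_add]
    exact le_rk f ((abs_add_le y w).trans (add_le_add hy hw))

/-- The modulus of a functional, as an additive map. -/
def absHom (f : StrongDual ℝ E) : E →+ ℝ where
  toFun x := rk f x⁺ - rk f x⁻
  map_zero' := by simp
  map_add' x y := by
    have h : (x + y)⁺ + (x⁻ + y⁻) = (x⁺ + y⁺) + (x + y)⁻ := by
      have h1 := posPart_sub_negPart (x + y)
      have h2 := posPart_sub_negPart x
      have h3 := posPart_sub_negPart y
      have e1 : (x + y)⁺ = x + y + (x + y)⁻ := by rw [← sub_eq_iff_eq_add]; exact h1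
      have e2 : x⁺ = x + x⁻ := by rw [← sub_eq_iff_eq_add]; exact h2
      have e3 : y⁺ = y + y⁻ := by rw [← sub_eq_iff_eq_add]; exact h3
      rw [e1, e2, e3]; abel
    have := congrArg (rk f) h
    rw [rk_add f (posPart_nonneg _) (add_nonneg (negPart_nonneg _) (negPart_nonneg _)),
      rk_add f (negPart_nonneg _) (negPart_nonneg _),
      rk_add f (add_nonneg (posPart_nonneg _) (posPart_nonneg _)) (negPart_nonneg _),
      rk_add f (posPart_nonneg _) (posPart_nonneg _)] at this
    linarith

theorem absHom_of_nonneg (f : StrongDual ℝ E) {x : E} (hx : 0 ≤ x) : absHom f x = rk f x := by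
  have h0 : rk f 0 = 0 := by simpa using rk_add f (le_refl (0 : E)) le_rfl
  simp [absHom, posPart_of_nonneg hx, negPart_of_nonneg hx, h0]

theorem absHom_bound (f : StrongDual ℝ E) (x : E) : ‖absHom f x‖ ≤ ‖f‖ * ‖x‖ := by
  have h : rk f x⁺ + rk f x⁻ ≤ ‖f‖ * ‖x‖ := by
    rw [← rk_add f (posPart_nonneg _) (negPart_nonneg _), posPart_add_negPart, ← norm_abs_eq_norm x]
    exact rk_le f (abs_nonneg x) fun y hy => rk_bound f hy
  have h1 := rk_nonneg f (posPart_nonneg x)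
  have h2 := rk_nonneg f (negPart_nonneg x)
  change |rk f x⁺ - rk f x⁻| ≤ _
  rw [abs_le]
  constructor <;> linarith

/-- The modulus of a functional, as a bounded functional. -/
def absDual (f : StrongDual ℝ E) : StrongDual ℝ E :=
  (absHom f).toRealLinearMap (AddMonoidHomClass.continuous_of_bound (absHom f) ‖f‖ (absHom_bound f))

theorem absDual_of_nonneg (f : StrongDual ℝ E) {x : E} (hx : 0 ≤ x) : absDual f x = rk f x :=
  absHom_of_nonneg f hx

theorem le_absDual (f : StrongDual ℝ E) : f ≤ absDual f := fun x hx => by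
  rw [absDual_of_nonneg f hx]
  exact le_rk f (abs_of_nonneg hx).le

theorem neg_le_absDual (f : StrongDual ℝ E) : -f ≤ absDual f := fun x hx => by
  rw [absDual_of_nonneg f hx]
  simpa using le_rk f (x := x) (y := -x) (by rw [abs_neg, abs_of_nonneg hx])

theorem absDual_le {f g : StrongDual ℝ E} (h₁ : f ≤ g) (h₂ : -f ≤ g) : absDual f ≤ g :=
  fun x hx => by
    rw [absDual_of_nonneg f hx]
    refine rk_le f hx fun y hy => ?_
    have hg : 0 ≤ g (x - |y|) := by
      have a := h₁ _ (sub_nonneg.2 hy)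
      have b : -f (x - |y|) ≤ g (x - |y|) := h₂ _ (sub_nonneg.2 hy)
      linarith
    have a := h₁ _ (posPart_nonneg y)
    have b : -f y⁻ ≤ g y⁻ := h₂ _ (negPart_nonneg y)
    have c : f y = f y⁺ - f y⁻ := by rw [← map_sub, posPart_sub_negPart]
    have d : g |y| = g y⁺ + g y⁻ := by rw [← map_add, posPart_add_negPart]
    rw [map_sub] at hg
    linarith

/-- The dual of a Banach lattice is a lattice. -/
instance instLattice : Lattice (StrongDual ℝ E) where
  sup f g := (1 / 2 : ℝ) • (f + g + absDual (f - g))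
  inf f g := (1 / 2 : ℝ) • (f + g - absDual (f - g))
  le_sup_left f g x hx := by
    have := le_absDual (f - g) x hx
    simp only [sub_apply, add_apply,
      smul_apply, smul_eq_mul] at *
    linarith
  le_sup_right f g x hx := by
    have := neg_le_absDual (f - g) x hx
    simp only [sub_apply, add_apply,
      neg_apply, smul_apply, smul_eq_mul] at *
    linarith
  sup_le f g k hf hg x hx := by
    have : absDual (f - g) ≤ (2 : ℝ) • k - (f + g) := by
      apply absDual_le <;> intro y hy <;> have a := hf y hy <;> have b := hg y hy <;>
      simp only [sub_apply, add_apply,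
        neg_apply, smul_apply, smul_eq_mul] <;> linarith
    have := this x hx
    simp only [sub_apply, add_apply,
      smul_apply, smul_eq_mul] at *
    linarith
  inf_le_left f g x hx := by
    have := neg_le_absDual (f - g) x hx
    simp only [sub_apply, add_apply,
      neg_apply, smul_apply, smul_eq_mul] at *
    linarith
  inf_le_right f g x hx := by
    have := le_absDual (f - g) x hx
    simp only [sub_apply, add_apply,
      smul_apply, smul_eq_mul] at *
    linarith
  le_inf k f g hf hg x hx := by
    have : absDual (f - g) ≤ (f + g) - (2 : ℝ) • k := by
      apply absDual_le <;> intro y hy <;> have a := hf y hy <;> have b := hg y hy <;>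
      simp only [sub_apply, add_apply,
        neg_apply, smul_apply, smul_eq_mul] <;> linarith
    have := this x hx
    simp only [sub_apply, add_apply,
      smul_apply, smul_eq_mul] at *
    linarith

/-- The Riesz-Kantorovich formula for the modulus `|f| = f ⊔ -f` in the dual. -/
theorem abs_apply (f : StrongDual ℝ E) {x : E} (hx : 0 ≤ x) :
    |f| x = sSup (f '' {y | |y| ≤ x}) := by
  have : |f| = absDual f :=
    le_antisymm (sup_le (le_absDual f) (neg_le_absDual f))
      (absDual_le (le_abs_self f) (neg_le_abs f))
  rw [this, absDual_of_nonneg f hx, rk]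

end Construction

end BanachLatticeDual

namespace AffiliatedOperators

/-! ### Null sequences and disjoint sequences -/

section Sequences

variable {X : Type*} [NormedAddCommGroup X] [NormedSpace ℝ X]

/-- `(x n)` converges to `0` in the weak topology. -/
def WeakNull (x : ℕ → X) : Prop :=
  Tendsto (fun n => toWeakSpace ℝ X (x n)) atTop (𝓝 0)

/-- `(f n)` converges to `0` in the weak-star topology of the dual. -/
def WeakStarNull (f : ℕ → StrongDual ℝ X) : Prop :=
  Tendsto (fun n => StrongDual.toWeakDual (f n)) atTop (𝓝 0)

/-- `(x n)` converges to `0` in norm. -/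
def NormNull (x : ℕ → X) : Prop :=
  Tendsto (fun n => ‖x n‖) atTop (𝓝 0)

/-- The terms of the sequence are pairwise disjoint: `|x n| ⊓ |x m| = 0` for `n ≠ m`. -/
def DisjointSeq {G : Type*} [Lattice G] [AddGroup G] (x : ℕ → G) : Prop :=
  Pairwise fun n m => |x n| ⊓ |x m| = 0

/-- Limited sets: every weak-star null sequence is uniformly null on the bounded set `A`. -/
def IsLimited (A : Set X) : Prop :=
  Bornology.IsBounded A ∧ ∀ f : ℕ → StrongDual ℝ X, WeakStarNull f →
    TendstoUniformlyOn (fun n a => f n a) (fun _ => 0) atTop A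

/-- Almost limited (a-limited) sets: every disjoint weak-star null sequence is uniformly null on
the bounded set `A`. -/
def IsAlmostLimited {E : Type*} [NormedAddCommGroup E] [NormedSpace ℝ E] [Lattice E]
    [IsOrderedAddMonoid E] [HasSolidNorm E] (A : Set E) : Prop :=
  Bornology.IsBounded A ∧ ∀ f : ℕ → StrongDual ℝ E, DisjointSeq f → WeakStarNull f →
    TendstoUniformlyOn (fun n a => f n a) (fun _ => 0) atTop A

/-- Relatively norm compact sets. -/
def RelCompact (A : Set X) : Prop := IsCompact (closure A)

/-- Relatively weakly compact sets. -/
def RelWeaklyCompact (A : Set X) : Prop := IsCompact (closure (toWeakSpace ℝ X '' A))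

end Sequences

/-! ### The classes of affiliated operators -/

section Classes

variable (E F : Type*)
  [NormedAddCommGroup E] [NormedSpace ℝ E] [Lattice E] [IsOrderedAddMonoid E] [HasSolidNorm E]
  [NormedAddCommGroup F] [NormedSpace ℝ F] [Lattice F] [IsOrderedAddMonoid F] [HasSolidNorm F]

variable {E F} in
/-- The adjoint `T' : F' → E'`, `T' f = f ∘ T`. -/
def adj (T : E →L[ℝ] F) (f : StrongDual ℝ F) : StrongDual ℝ E := f.comp T

/-- [PSP]: positive Schur. -/
def PSP : Set (E →L[ℝ] F) :=
  {T | ∀ x : ℕ → E, (∀ n, 0 ≤ x n) → WeakNull x → NormNull fun n => T (x n)}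

/-- [DPSP]: dual positive Schur. -/
def DPSP : Set (E →L[ℝ] F) :=
  {T | ∀ f : ℕ → StrongDual ℝ F, (∀ n, 0 ≤ f n) → WeakStarNull f → NormNull fun n => adj T (f n)}

/-- [DDSP]: dual disjoint Schur. -/
def DDSP : Set (E →L[ℝ] F) :=
  {T | ∀ f : ℕ → StrongDual ℝ F, DisjointSeq f → WeakStarNull f → NormNull fun n => adj T (f n)}

/-- [PGP]: positive Grothendieck. -/
def PGP : Set (E →L[ℝ] F) :=
  {T | ∀ f : ℕ → StrongDual ℝ F, (∀ n, 0 ≤ f n) → WeakStarNull f → WeakNull fun n => adj T (f n)}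

/-- [DGP]: disjoint Grothendieck. -/
def DGP : Set (E →L[ℝ] F) :=
  {T | ∀ f : ℕ → StrongDual ℝ F, DisjointSeq f → WeakStarNull f → WeakNull fun n => adj T (f n)}

/-- [swl]. -/
def Swl : Set (E →L[ℝ] F) :=
  {T | ∀ x : ℕ → E, WeakNull x → WeakNull fun n => |T (x n)|}

/-- [dswl]. -/
def Dswl : Set (E →L[ℝ] F) :=
  {T | ∀ x : ℕ → E, DisjointSeq x → WeakNull x → WeakNull fun n => |T (x n)|}

/-- [sw*l]. -/
def SwStarl : Set (E →L[ℝ] F) :=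
  {T | ∀ f : ℕ → StrongDual ℝ F, WeakStarNull f → WeakStarNull fun n => |adj T (f n)|}

/-- [d]. -/
def PropD : Set (E →L[ℝ] F) :=
  {T | ∀ f : ℕ → StrongDual ℝ F, DisjointSeq f → WeakStarNull f →
    WeakStarNull fun n => |adj T (f n)|}

/-- [bi-sP]: bi-sequence property. -/
def BiSP : Set (E →L[ℝ] F) :=
  {T | ∀ (f : ℕ → StrongDual ℝ F) (x : ℕ → E), (∀ n, 0 ≤ f n) → WeakStarNull f →
    DisjointSeq x → WeakNull x → Tendsto (fun n => f n (T (x n))) atTop (𝓝 0)}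

/-- [GPP]: Gelfand-Phillips. -/
def GPP : Set (E →L[ℝ] F) := {T | ∀ A : Set E, IsLimited A → RelCompact (T '' A)}

/-- [s-GPP]: strong Gelfand-Phillips. -/
def SGPP : Set (E →L[ℝ] F) := {T | ∀ A : Set E, IsAlmostLimited A → RelCompact (T '' A)}

/-- [BDP]: Bourgain-Diestel. -/
def BDP : Set (E →L[ℝ] F) := {T | ∀ A : Set E, IsLimited A → RelWeaklyCompact (T '' A)}

/-- [s-BDP]: strong Bourgain-Diestel. -/
def SBDP : Set (E →L[ℝ] F) := {T | ∀ A : Set E, IsAlmostLimited A → RelWeaklyCompact (T '' A)}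

end Classes

/-! ### Regularly `P`-operators and the enveloping norm -/

section Enveloping

variable {E F : Type*}
  [NormedAddCommGroup E] [NormedSpace ℝ E] [Lattice E]
  [NormedAddCommGroup F] [NormedSpace ℝ F] [Lattice F]

/-- The order on operators: `S ≤ T` iff `S x ≤ T x` for every `x ≥ 0`. -/
def OpLE (S T : E →L[ℝ] F) : Prop := ∀ x : E, 0 ≤ x → S x ≤ T x

/-- The regularly `P`-operators: differences of two positive members of `P`. -/
def regularly (P : Set (E →L[ℝ] F)) : Set (E →L[ℝ] F) :=
  {T | ∃ T₁ ∈ P, ∃ T₂ ∈ P, OpLE 0 T₁ ∧ OpLE 0 T₂ ∧ T = T₁ - T₂}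

/-- The enveloping norm `inf {‖S‖ : ±T ≤ S ∈ P}`. -/
def envelopingNorm (P : Set (E →L[ℝ] F)) (T : E →L[ℝ] F) : ℝ :=
  sInf {r | ∃ S ∈ P, OpLE T S ∧ OpLE (-T) S ∧ r = ‖S‖}

end Enveloping

/-- The subset `V` of the real vector space `M` is a linear subspace, `N` restricts to a norm
on it, and it is complete under this norm. -/
def IsBanachUnder {M : Type*} [AddCommGroup M] [Module ℝ M] (V : Set M) (N : M → ℝ) : Prop :=
  ∃ W : Submodule ℝ M, (W : Set M) = V ∧
    letI : Norm W := ⟨fun T => N T⟩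
    ∃ core : NormedSpace.Core ℝ W,
      letI : NormedAddCommGroup W := NormedAddCommGroup.ofCore core
      CompleteSpace W

end AffiliatedOperators

end

/-!
The proof has two independent halves.

*Closed subspaces suffice.* Let `W` be a norm-closed subspace of `L(E, F)`. If `±T ≤ S`, then
`|T x| ≤ S |x|`, so `‖T‖ ≤ ‖S‖`; hence the enveloping norm dominates the operator norm and is a
norm on the regularly `W`-operators. For completeness take a series of regularly `W`-operators
`u n` with summable enveloping norms, and dominants `S n ∈ W` of `u n` whose norms exceed these by
at most `2⁻ⁿ`. Both `∑ u n` and `∑ S n` converge in the operator norm, to members of `W`, and the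
tails of the first series are dominated by the tails of the second, whose norms tend to `0`; so the
series `∑ u n` converges in the enveloping norm. See `exists_tendsto_envelopingNorm` and
`isBanachUnder_regularly`.

*Each class is a closed subspace.* Ten classes are of the form "the seminorms `p (L n T)` tend to
`0`", with `(L n)` a bounded sequence of operators by uniform boundedness; the moduli enter through
the lattice seminorms `y ↦ φ |y|` and `f ↦ |f| x`, as weak convergence of moduli need only be tested
on positive elements (`isClosedSubspace_setOf_tendsto`). For the other four classes, relative
compactness of `T(A)` means that `T` converges along each ultrafilter containing `A`
(`isCompact_closure_image_iff`). This is clearly linear in `T`. If `T` is a norm limit of operators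
`S n` with this property for the weak topology, the weak limits `y n` of `S n` along the ultrafilter
form a norm-Cauchy sequence, since `A` is bounded, and `T` tends weakly to its limit
(`isClosedSubspace_relWeaklyCompact`).
-/

namespace AffiliatedOperators

/-! ### The enveloping norm of a closed subspace -/

section EnvelopingNorm

variable {E F : Type*}
  [NormedAddCommGroup E] [NormedSpace ℝ E] [Lattice E] [IsOrderedAddMonoid E] [HasSolidNorm E]
  [NormedAddCommGroup F] [NormedSpace ℝ F] [Lattice F] [IsOrderedAddMonoid F] [HasSolidNorm F]

/-- The operators dominated by `S` have norm at most `‖S‖`, because `|T x| ≤ S |x|`. -/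
theorem norm_le_norm_of_opLE {S T : E →L[ℝ] F} (h₁ : OpLE T S) (h₂ : OpLE (-T) S) :
    ‖T‖ ≤ ‖S‖ := by
  refine T.opNorm_le_bound (norm_nonneg S) fun x => ?_
  have hx : |T x| ≤ S |x| := by
    have e : T x = T x⁺ - T x⁻ := by rw [← map_sub, posPart_sub_negPart]
    have d : S |x| = S x⁺ + S x⁻ := by rw [← map_add, posPart_add_negPart]
    have p₁ := h₁ _ (posPart_nonneg x)
    have p₂ := h₁ _ (negPart_nonneg x)
    have n₁ : -T x⁺ ≤ S x⁺ := h₂ _ (posPart_nonneg x)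
    have n₂ : -T x⁻ ≤ S x⁻ := h₂ _ (negPart_nonneg x)
    rw [e, d, abs_le']
    refine ⟨?_, ?_⟩
    · rw [sub_eq_add_neg]; exact add_le_add p₁ n₂
    · rw [neg_sub, sub_eq_neg_add]; exact add_le_add n₁ p₂
  calc ‖T x‖ ≤ ‖S |x|‖ := norm_le_norm_of_abs_le_abs (hx.trans (le_abs_self _))
    _ ≤ ‖S‖ * ‖|x|‖ := S.le_opNorm _
    _ = ‖S‖ * ‖x‖ := by rw [norm_abs_eq_norm]

variable {P : Set (E →L[ℝ] F)} {S T : E →L[ℝ] F}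

theorem envelopingNorm_le (hS : S ∈ P) (h₁ : OpLE T S) (h₂ : OpLE (-T) S) :
    envelopingNorm P T ≤ ‖S‖ :=
  csInf_le ⟨0, by rintro _ ⟨S, -, -, -, rfl⟩; exact norm_nonneg S⟩ ⟨S, hS, h₁, h₂, rfl⟩

theorem envelopingNorm_nonneg (P : Set (E →L[ℝ] F)) (T : E →L[ℝ] F) :
    0 ≤ envelopingNorm P T :=
  Real.sInf_nonneg (by rintro _ ⟨S, -, -, -, rfl⟩; exact norm_nonneg S)

variable (W : Submodule ℝ (E →L[ℝ] F))

/-- An operator is a difference of two positive members of the subspace `W` iff it belongs to `W`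
and is dominated by a member of `W`. -/
theorem mem_regularly_iff :
    T ∈ regularly (W : Set (E →L[ℝ] F)) ↔ T ∈ W ∧ ∃ S ∈ W, OpLE T S ∧ OpLE (-T) S := by
  constructor
  · rintro ⟨T₁, h₁, T₂, h₂, p₁, p₂, rfl⟩
    refine ⟨W.sub_mem h₁ h₂, T₁ + T₂, W.add_mem h₁ h₂, fun x hx => ?_, fun x hx => ?_⟩
    · have : (0 : F) ≤ T₂ x := p₂ x hx
      change T₁ x - T₂ x ≤ T₁ x + T₂ x
      exact (sub_le_self _ this).trans (le_add_of_nonneg_right this)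
    · have : (0 : F) ≤ T₁ x := p₁ x hx
      change -(T₁ x - T₂ x) ≤ T₁ x + T₂ x
      rw [neg_sub]
      exact (sub_le_self _ this).trans (le_add_of_nonneg_left this)
  · rintro ⟨hT, S, hS, h₁, h₂⟩
    have h : ∀ x : E, 0 ≤ x → T x ≤ S x ∧ -T x ≤ S x := fun x hx => ⟨h₁ x hx, h₂ x hx⟩
    refine ⟨S, hS, S - T, W.sub_mem hS hT, fun x hx => ?_, fun x hx => ?_, by abel⟩
    · exact (abs_nonneg (T x)).trans (abs_le'.2 (h x hx))
    · exact sub_nonneg.2 (h x hx).1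

theorem exists_norm_lt_envelopingNorm_add (hT : T ∈ regularly (W : Set (E →L[ℝ] F)))
    {ε : ℝ} (hε : 0 < ε) :
    ∃ S ∈ W, OpLE T S ∧ OpLE (-T) S ∧ ‖S‖ < envelopingNorm (W : Set (E →L[ℝ] F)) T + ε := by
  obtain ⟨-, S, hS, h₁, h₂⟩ := (mem_regularly_iff W).1 hT
  obtain ⟨_, ⟨S, hS, h₁, h₂, rfl⟩, hlt⟩ := exists_lt_of_csInf_lt
    (s := {r | ∃ S ∈ (W : Set (E →L[ℝ] F)), OpLE T S ∧ OpLE (-T) S ∧ r = ‖S‖})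
    ⟨_, S, hS, h₁, h₂, rfl⟩ (lt_add_of_pos_right _ hε)
  exact ⟨S, hS, h₁, h₂, hlt⟩

/-- The enveloping norm dominates the operator norm. -/
theorem norm_le_envelopingNorm (hT : T ∈ regularly (W : Set (E →L[ℝ] F))) :
    ‖T‖ ≤ envelopingNorm (W : Set (E →L[ℝ] F)) T := by
  refine le_of_forall_pos_lt_add fun ε hε => ?_
  obtain ⟨S, -, h₁, h₂, h⟩ := exists_norm_lt_envelopingNorm_add W hT hε
  exact (norm_le_norm_of_opLE h₁ h₂).trans_lt h

theorem OpLE.add {S T S' T' : E →L[ℝ] F} (h : OpLE S T) (h' : OpLE S' T') :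
    OpLE (S + S') (T + T') :=
  fun x hx => add_le_add (h x hx) (h' x hx)

theorem envelopingNorm_add_le {T' : E →L[ℝ] F} (hT : T ∈ regularly (W : Set (E →L[ℝ] F)))
    (hT' : T' ∈ regularly (W : Set (E →L[ℝ] F))) :
    envelopingNorm (W : Set (E →L[ℝ] F)) (T + T') ≤
      envelopingNorm (W : Set (E →L[ℝ] F)) T + envelopingNorm (W : Set (E →L[ℝ] F)) T' := by
  refine le_of_forall_pos_lt_add fun ε hε => ?_
  obtain ⟨S, hS, h₁, h₂, h⟩ := exists_norm_lt_envelopingNorm_add W hT (half_pos hε)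
  obtain ⟨S', hS', h₁', h₂', h'⟩ := exists_norm_lt_envelopingNorm_add W hT' (half_pos hε)
  have := envelopingNorm_le (P := (W : Set (E →L[ℝ] F))) (W.add_mem hS hS') (h₁.add h₁')
    (by rw [neg_add]; exact h₂.add h₂')
  have := norm_add_le S S'
  linarith

variable [IsOrderedModule ℝ F]

theorem OpLE.abs_smul (h₁ : OpLE T S) (h₂ : OpLE (-T) S) (c : ℝ) : OpLE (c • T) (|c| • S) := by
  intro x hx
  change c • T x ≤ |c| • S x
  rcases le_total 0 c with hc | hc
  · rw [abs_of_nonneg hc]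
    exact smul_le_smul_of_nonneg_left (h₁ x hx) hc
  · rw [abs_of_nonpos hc, ← neg_smul_neg]
    exact smul_le_smul_of_nonneg_left (h₂ x hx) (neg_nonneg.2 hc)

theorem envelopingNorm_smul_le (hT : T ∈ regularly (W : Set (E →L[ℝ] F))) (c : ℝ) :
    envelopingNorm (W : Set (E →L[ℝ] F)) (c • T) ≤
      |c| * envelopingNorm (W : Set (E →L[ℝ] F)) T := by
  have key : ∀ ε > 0, envelopingNorm (W : Set (E →L[ℝ] F)) (c • T) ≤
      |c| * (envelopingNorm (W : Set (E →L[ℝ] F)) T + ε) := fun ε hε => by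
    obtain ⟨S, hS, h₁, h₂, h⟩ := exists_norm_lt_envelopingNorm_add W hT hε
    refine (envelopingNorm_le (P := (W : Set (E →L[ℝ] F))) (W.smul_mem |c| hS)
      (h₁.abs_smul h₂ c) ?_).trans ?_
    · rw [← neg_smul, ← abs_neg]
      exact h₁.abs_smul h₂ (-c)
    · rw [norm_smul, Real.norm_eq_abs, abs_abs]
      gcongr
  have lim : Tendsto (fun ε : ℝ => |c| * (envelopingNorm (W : Set (E →L[ℝ] F)) T + ε))
      (𝓝[>] 0) (𝓝 (|c| * envelopingNorm (W : Set (E →L[ℝ] F)) T)) := by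
    have : Continuous fun ε : ℝ => |c| * (envelopingNorm (W : Set (E →L[ℝ] F)) T + ε) := by
      fun_prop
    simpa using (this.tendsto 0).mono_left nhdsWithin_le_nhds
  exact ge_of_tendsto lim (eventually_mem_nhdsWithin.mono key)

theorem envelopingNorm_smul (hT : T ∈ regularly (W : Set (E →L[ℝ] F))) (c : ℝ)
    (hcT : c • T ∈ regularly (W : Set (E →L[ℝ] F))) :
    envelopingNorm (W : Set (E →L[ℝ] F)) (c • T) =
      |c| * envelopingNorm (W : Set (E →L[ℝ] F)) T := by
  refine le_antisymm (envelopingNorm_smul_le W hT c) ?_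
  rcases eq_or_ne c 0 with rfl | hc
  · simpa using envelopingNorm_nonneg _ _
  · have := envelopingNorm_smul_le W hcT c⁻¹
    rw [inv_smul_smul₀ hc, abs_inv] at this
    rwa [← le_inv_mul_iff₀ (abs_pos.2 hc)]

/-- The regularly `W`-operators, as a subspace. -/
def regularlySubmodule : Submodule ℝ (E →L[ℝ] F) where
  carrier := regularly (W : Set (E →L[ℝ] F))
  zero_mem' := ⟨0, W.zero_mem, 0, W.zero_mem, fun _ _ => le_rfl, fun _ _ => le_rfl, by simp⟩
  add_mem' := by
    intro S T hS hT
    rw [mem_regularly_iff] at *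
    obtain ⟨hS, S', hS', h₁, h₂⟩ := hS
    obtain ⟨hT, T', hT', h₁', h₂'⟩ := hT
    exact ⟨W.add_mem hS hT, S' + T', W.add_mem hS' hT', h₁.add h₁',
      by rw [neg_add]; exact h₂.add h₂'⟩
  smul_mem' := by
    intro c T hT
    rw [mem_regularly_iff] at *
    obtain ⟨hT, S, hS, h₁, h₂⟩ := hT
    refine ⟨W.smul_mem c hT, |c| • S, W.smul_mem _ hS, h₁.abs_smul h₂ c, ?_⟩
    rw [← neg_smul, ← abs_neg]
    exact h₁.abs_smul h₂ (-c)

/-- A space with a norm in the sense of `NormedSpace.Core` is complete as soon as its absolutely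
convergent series converge. -/
theorem completeSpace_ofCore {V : Type*} [AddCommGroup V] [Module ℝ V] [Norm V]
    (core : NormedSpace.Core ℝ V)
    (h : ∀ u : ℕ → V, Summable (fun n => ‖u n‖) →
      ∃ a, Tendsto (fun n => ‖∑ i ∈ Finset.range n, u i - a‖) atTop (𝓝 0)) :
    letI : NormedAddCommGroup V := NormedAddCommGroup.ofCore core
    CompleteSpace V := by
  let : NormedAddCommGroup V := NormedAddCommGroup.ofCore core
  refine NormedAddCommGroup.completeSpace_of_summable_imp_tendsto fun u hu => ?_
  obtain ⟨a, ha⟩ := h u hu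
  exact ⟨a, tendsto_iff_norm_sub_tendsto_zero.2 ha⟩

/-- Termwise domination passes to sums of series. -/
theorem opLE_of_hasSum {u v : ℕ → E →L[ℝ] F} (hu : HasSum u T) (hv : HasSum v S)
    (h : ∀ n, OpLE (u n) (v n)) : OpLE T S := fun x hx =>
  hasSum_le (fun n => h n x hx) (hu.mapL (ContinuousLinearMap.apply ℝ F x))
    (hv.mapL (ContinuousLinearMap.apply ℝ F x))

variable [CompleteSpace F]

/-- If a series of regularly `W`-operators has summable enveloping norms and `W` is closed, then the
series converges in the enveloping norm. Choosing dominants `S n ∈ W` of the terms `u n` with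
summable norms, the tails of `∑ u n` are dominated by the tails of `∑ S n`. -/
theorem exists_tendsto_envelopingNorm (hW : IsClosed (W : Set (E →L[ℝ] F)))
    (u : ℕ → E →L[ℝ] F) (hu : ∀ n, u n ∈ regularly (W : Set (E →L[ℝ] F)))
    (hsum : Summable fun n => envelopingNorm (W : Set (E →L[ℝ] F)) (u n)) :
    ∃ T ∈ regularly (W : Set (E →L[ℝ] F)),
      Tendsto (fun n => envelopingNorm (W : Set (E →L[ℝ] F)) (∑ i ∈ Finset.range n, u i - T))
        atTop (𝓝 0) := by
  choose S hS h₁ h₂ hlt using fun n => exists_norm_lt_envelopingNorm_add W (hu n)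
    (ε := (1 / 2) ^ n) (by positivity)
  have hSn : Summable fun n => ‖S n‖ :=
    (hsum.add summable_geometric_two).of_nonneg_of_le (fun _ => norm_nonneg _)
      fun n => (hlt n).le
  have hun : Summable fun n => ‖u n‖ :=
    hSn.of_nonneg_of_le (fun _ => norm_nonneg _) fun n => norm_le_norm_of_opLE (h₁ n) (h₂ n)
  have hSs := hSn.of_norm
  have hus := hun.of_norm
  have mem : ∀ v : ℕ → E →L[ℝ] F, (∀ n, v n ∈ W) → Summable v → ∑' n, v n ∈ W :=
    fun v hv hs => hW.mem_of_tendsto hs.hasSum.tendsto_sum_nat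
      (Eventually.of_forall fun n => W.sum_mem fun i _ => hv i)
  have huW : ∀ n, u n ∈ W := fun n => ((mem_regularly_iff W).1 (hu n)).1
  refine ⟨∑' n, u n, (mem_regularly_iff W).2 ⟨mem u huW hus, ∑' n, S n, mem S hS hSs,
    opLE_of_hasSum hus.hasSum hSs.hasSum h₁, opLE_of_hasSum hus.hasSum.neg hSs.hasSum h₂⟩, ?_⟩
  have tail : Tendsto (fun n => ‖∑' k, S (k + n)‖) atTop (𝓝 0) := by
    simpa using (tendsto_sum_nat_add S).norm
  refine squeeze_zero (fun n => envelopingNorm_nonneg _ _) (fun n => ?_) tail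
  have hus' : HasSum (fun k => u (k + n)) (∑' k, u (k + n)) :=
    ((summable_nat_add_iff n).2 hus).hasSum
  have hSs' : HasSum (fun k => S (k + n)) (∑' k, S (k + n)) :=
    ((summable_nat_add_iff n).2 hSs).hasSum
  have e : ∑ i ∈ Finset.range n, u i - ∑' i, u i = -∑' k, u (k + n) := by
    rw [← hus.sum_add_tsum_nat_add n]; abel
  rw [e]
  refine envelopingNorm_le (mem _ (fun k => hS _) hSs'.summable)
    (opLE_of_hasSum hus'.neg hSs' fun k => h₂ _) ?_
  rw [neg_neg]
  exact opLE_of_hasSum hus' hSs' fun k => h₁ _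

/-- If `W` is a closed subspace of `L(E, F)`, the regularly `W`-operators form a Banach space under
the enveloping norm. -/
theorem isBanachUnder_regularly (hW : IsClosed (W : Set (E →L[ℝ] F))) :
    IsBanachUnder (regularly (W : Set (E →L[ℝ] F)))
      (envelopingNorm (W : Set (E →L[ℝ] F))) := by
  refine ⟨regularlySubmodule W, rfl, ?_⟩
  let : Norm (regularlySubmodule W) := ⟨fun T => envelopingNorm (W : Set (E →L[ℝ] F)) T⟩
  have core : NormedSpace.Core ℝ (regularlySubmodule W) :=
    { norm_nonneg := fun T => envelopingNorm_nonneg _ _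
      norm_smul := fun c T => envelopingNorm_smul W T.2 c (c • T).2
      norm_triangle := fun S T => envelopingNorm_add_le W S.2 T.2
      norm_eq_zero_iff := fun T => by
        constructor
        · intro h
          have h0 := norm_le_envelopingNorm W T.2
          change envelopingNorm (W : Set (E →L[ℝ] F)) T = 0 at h
          rw [h] at h0
          exact Subtype.ext (norm_le_zero_iff.1 h0)
        · rintro rfl
          refine le_antisymm ?_ (envelopingNorm_nonneg _ _)
          have := envelopingNorm_smul_le W (regularlySubmodule W).zero_mem 0
          rwa [zero_smul, abs_zero, zero_mul] at this }
  refine ⟨core, completeSpace_ofCore core fun u hu => ?_⟩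
  obtain ⟨T, hT, h⟩ := exists_tendsto_envelopingNorm W hW (fun n => u n) (fun n => (u n).2) hu
  refine ⟨⟨T, hT⟩, h.congr fun n => ?_⟩
  change _ = envelopingNorm (W : Set (E →L[ℝ] F)) ((∑ i ∈ Finset.range n, u i - ⟨T, hT⟩ :
    regularlySubmodule W) : E →L[ℝ] F)
  simp

end EnvelopingNorm

/-! ### Weakly null and weak-star null sequences -/

section NullSequences

variable {X : Type*} [NormedAddCommGroup X] [NormedSpace ℝ X]

/-- Weak convergence is tested on functionals. -/
theorem tendsto_toWeakSpace_iff {α : Type*} {l : Filter α} {m : α → X} {y : X} :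
    Tendsto (fun a => toWeakSpace ℝ X (m a)) l (𝓝 (toWeakSpace ℝ X y)) ↔
      ∀ φ : StrongDual ℝ X, Tendsto (fun a => φ (m a)) l (𝓝 (φ y)) := by
  have hinj : Function.Injective (topDualPairing ℝ X).flip := fun x y h =>
    SeparatingDual.eq_iff_forall_dual_eq (R := ℝ) |>.2 fun φ => LinearMap.congr_fun h φ
  exact WeakBilin.tendsto_iff_forall_eval_tendsto _ hinj

theorem weakNull_iff {x : ℕ → X} :
    WeakNull x ↔ ∀ φ : StrongDual ℝ X, Tendsto (fun n => φ (x n)) atTop (𝓝 0) := by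
  simpa using! tendsto_toWeakSpace_iff (m := x) (l := atTop) (y := 0)

theorem weakStarNull_iff {f : ℕ → StrongDual ℝ X} :
    WeakStarNull f ↔ ∀ x : X, Tendsto (fun n => f n x) atTop (𝓝 0) := by
  rw [WeakStarNull, tendsto_iff_forall_eval_tendsto_topDualPairing]
  rfl

theorem WeakStarNull.bounded [CompleteSpace X] {f : ℕ → StrongDual ℝ X} (h : WeakStarNull f) :
    ∃ C, ∀ n, ‖f n‖ ≤ C := by
  refine banach_steinhaus fun x => ?_
  obtain ⟨C, hC⟩ := (weakStarNull_iff.1 h x).norm.bddAbove_range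
  exact ⟨C, fun n => hC ⟨n, rfl⟩⟩

theorem WeakNull.bounded {x : ℕ → X} (h : WeakNull x) : ∃ C, ∀ n, ‖x n‖ ≤ C := by
  obtain ⟨C, hC⟩ := WeakStarNull.bounded
    (f := fun n => NormedSpace.inclusionInDoubleDualLi (𝕜 := ℝ) (x n))
    (weakStarNull_iff.2 fun φ => weakNull_iff.1 h φ)
  exact ⟨C, fun n => ((NormedSpace.inclusionInDoubleDualLi ℝ).norm_map (x n)).ge.trans (hC n)⟩

end NullSequences

section Modulus

open BanachLatticeDual

/-- In an ordered module, `|c • y| ≤ |c| • |y|`. -/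
theorem abs_smul_le_abs_smul_abs {G : Type*} [Lattice G] [AddCommGroup G] [IsOrderedAddMonoid G]
    [Module ℝ G] [PosSMulMono ℝ G] (c : ℝ) (y : G) : |c • y| ≤ |c| • |y| := by
  have key : ∀ c : ℝ, c • y ≤ |c| • |y| := fun c => by
    rcases le_total 0 c with hc | hc
    · rw [abs_of_nonneg hc]
      exact smul_le_smul_of_nonneg_left (le_abs_self y) hc
    · rw [abs_of_nonpos hc, ← neg_smul_neg]
      exact smul_le_smul_of_nonneg_left (neg_le_abs y) (neg_nonneg.2 hc)
  refine abs_le'.2 ⟨key c, ?_⟩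
  rw [← neg_smul, ← abs_neg c]
  exact key (-c)

variable {G : Type*} [NormedAddCommGroup G] [NormedSpace ℝ G] [Lattice G] [IsOrderedAddMonoid G]
  [HasSolidNorm G]

instance : PosSMulMono ℝ (StrongDual ℝ G) where
  smul_le_smul_of_nonneg_left _ hc _ _ h x hx := mul_le_mul_of_nonneg_left (h x hx) hc

theorem apply_mono_of_nonneg {φ : StrongDual ℝ G} (hφ : 0 ≤ φ) {x y : G} (h : x ≤ y) :
    φ x ≤ φ y := by
  have : 0 ≤ φ (y - x) := hφ _ (sub_nonneg.2 h)
  rwa [map_sub, sub_nonneg] at this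

theorem weakNull_abs_iff {x : ℕ → G} :
    WeakNull (fun n => |x n|) ↔
      ∀ φ : StrongDual ℝ G, 0 ≤ φ → Tendsto (fun n => φ |x n|) atTop (𝓝 0) := by
  refine weakNull_iff.trans ⟨fun h φ _ => h φ, fun h φ => ?_⟩
  have := (h _ (posPart_nonneg φ)).sub (h _ (negPart_nonneg φ))
  rw [sub_zero] at this
  refine this.congr fun n => ?_
  rw [← sub_apply, posPart_sub_negPart]

theorem weakStarNull_iff_nonneg {f : ℕ → StrongDual ℝ G} :
    WeakStarNull f ↔ ∀ x : G, 0 ≤ x → Tendsto (fun n => f n x) atTop (𝓝 0) := by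
  refine weakStarNull_iff.trans ⟨fun h x _ => h x, fun h x => ?_⟩
  have := (h _ (posPart_nonneg x)).sub (h _ (negPart_nonneg x))
  rw [sub_zero] at this
  refine this.congr fun n => ?_
  rw [← map_sub, posPart_sub_negPart]

/-- The lattice seminorm `y ↦ φ |y|` of a positive functional `φ`. -/
noncomputable def absSeminorm [IsOrderedModule ℝ G] (φ : StrongDual ℝ G) (hφ : 0 ≤ φ) : Seminorm ℝ G :=
  Seminorm.ofSMulLE (fun y => φ |y|) (by simp)
    (fun x y => by rw [← map_add]; exact apply_mono_of_nonneg hφ (abs_add_le x y))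
    (fun c y => by
      rw [Real.norm_eq_abs, ← smul_eq_mul, ← map_smul]
      exact apply_mono_of_nonneg hφ (abs_smul_le_abs_smul_abs c y))

theorem absSeminorm_le [IsOrderedModule ℝ G] (φ : StrongDual ℝ G) (hφ : 0 ≤ φ) (y : G) :
    absSeminorm φ hφ y ≤ ‖φ‖ * ‖y‖ := by
  rw [← norm_abs_eq_norm y]
  exact (Real.le_norm_self _).trans (φ.le_opNorm |y|)

/-- The lattice seminorm `f ↦ |f| x` on the dual, for `x ≥ 0`. -/
noncomputable def dualAbsSeminorm (x : G) (hx : 0 ≤ x) : Seminorm ℝ (StrongDual ℝ G) :=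
  Seminorm.ofSMulLE (fun f => |f| x) (by simp)
    (fun f g => abs_add_le f g x hx)
    (fun c f => abs_smul_le_abs_smul_abs c f x hx)

theorem dualAbsSeminorm_le (x : G) (hx : 0 ≤ x) (f : StrongDual ℝ G) :
    dualAbsSeminorm x hx f ≤ ‖x‖ * ‖f‖ := by
  change |f| x ≤ _
  rw [abs_apply f hx, mul_comm]
  exact rk_le f hx fun y hy => rk_bound f hy

end Modulus

/-! ### Closed subspaces defined by null sequences -/

section NullSubspace

variable {M G : Type*} [NormedAddCommGroup M] [NormedSpace ℝ M]
  [NormedAddCommGroup G] [NormedSpace ℝ G]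

/-- `P` is the underlying set of a norm-closed linear subspace. -/
def IsClosedSubspace (P : Set M) : Prop :=
  ∃ W : Submodule ℝ M, IsClosed (W : Set M) ∧ (W : Set M) = P

/-- The vectors `T` for which the seminorms of `L i n T` tend to `0` as `n → ∞`, for every `i`, form
a closed subspace, provided that each sequence `(L i n)` of operators is bounded. -/
theorem isClosedSubspace_setOf_tendsto {ι : Type*} (p : ι → Seminorm ℝ G)
    (hp : ∀ i, ∃ c, ∀ y, p i y ≤ c * ‖y‖) (L : ι → ℕ → M →L[ℝ] G)
    (hL : ∀ i, ∃ C, ∀ n, ‖L i n‖ ≤ C) :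
    IsClosedSubspace {T | ∀ i, Tendsto (fun n => p i (L i n T)) atTop (𝓝 0)} := by
  let W : Submodule ℝ M :=
    { carrier := {T | ∀ i, Tendsto (fun n => p i (L i n T)) atTop (𝓝 0)}
      zero_mem' := fun i => by simp
      add_mem' := fun {S T} hS hT i => by
        refine squeeze_zero (fun n => apply_nonneg _ _) (fun n => ?_)
          (by simpa using (hS i).add (hT i))
        rw [map_add]
        exact map_add_le_add _ _ _
      smul_mem' := fun c T hT i => by
        simpa [map_smul_eq_mul] using (hT i).const_mul ‖c‖ }
  refine ⟨W, isClosed_of_closure_subset fun T hT i => ?_, rfl⟩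
  obtain ⟨c, hc⟩ := hp i
  obtain ⟨C, hC⟩ := hL i
  have hC0 : 0 ≤ C := (norm_nonneg _).trans (hC 0)
  rw [Metric.tendsto_atTop]
  intro ε hε
  have hK : 0 < |c| * C + 1 := by positivity
  obtain ⟨S, hS, hTS⟩ := Metric.mem_closure_iff.1 hT (ε / 2 / (|c| * C + 1)) (by positivity)
  obtain ⟨N, hN⟩ := Metric.tendsto_atTop.1 (hS i) (ε / 2) (half_pos hε)
  refine ⟨N, fun n hn => ?_⟩
  have h₁ := hN n hn
  rw [Real.dist_0_eq_abs, abs_of_nonneg (apply_nonneg _ _)] at h₁ ⊢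
  have h₂ : p i (L i n (T - S)) ≤ |c| * C * ‖T - S‖ := by
    calc p i (L i n (T - S)) ≤ c * ‖L i n (T - S)‖ := hc _
      _ ≤ |c| * (C * ‖T - S‖) := by
        gcongr
        · exact le_abs_self c
        · exact (L i n).le_of_opNorm_le (hC n) _
      _ = _ := by ring
  rw [dist_eq_norm, lt_div_iff₀ hK] at hTS
  have h₃ : p i (L i n T) ≤ p i (L i n S) + p i (L i n (T - S)) := by
    have := map_add_le_add (p i) (L i n S) (L i n (T - S))
    rwa [← map_add, add_sub_cancel] at this
  nlinarith [norm_nonneg (T - S)]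

end NullSubspace

/-! ### The classes tested on null sequences -/

section SequentialClasses

variable {E F : Type*}
  [NormedAddCommGroup E] [NormedSpace ℝ E] [Lattice E] [IsOrderedAddMonoid E] [HasSolidNorm E]
  [NormedAddCommGroup F] [NormedSpace ℝ F] [Lattice F] [IsOrderedAddMonoid F] [HasSolidNorm F]

/-- The map `T ↦ T' f`, as a bounded operator. -/
noncomputable def adjCLM (f : StrongDual ℝ F) : (E →L[ℝ] F) →L[ℝ] StrongDual ℝ E :=
  ContinuousLinearMap.compL ℝ E F ℝ f

theorem norm_adjCLM_le (f : StrongDual ℝ F) : ‖adjCLM (E := E) f‖ ≤ ‖f‖ :=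
  ContinuousLinearMap.opNorm_le_bound _ (norm_nonneg f) fun T => f.opNorm_comp_le T

/-- Evaluation at `x`, as a bounded operator on `L(E, F)`. -/
noncomputable def evalCLM (x : E) : (E →L[ℝ] F) →L[ℝ] F := ContinuousLinearMap.apply ℝ F x

theorem norm_evalCLM_le (x : E) : ‖evalCLM (F := F) x‖ ≤ ‖x‖ :=
  ContinuousLinearMap.opNorm_le_bound _ (norm_nonneg x) fun T => by
    rw [mul_comm]; exact T.le_opNorm x

theorem exists_normSeminorm_le {G : Type*} [NormedAddCommGroup G] [NormedSpace ℝ G] :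
    ∃ c : ℝ, ∀ y : G, normSeminorm ℝ G y ≤ c * ‖y‖ :=
  ⟨1, fun y => by simp⟩

/-- For any family of bounded sequences `f` in `F'`, the operators with `‖T' (f n)‖ → 0`
form a closed subspace. -/
theorem isClosedSubspace_adj_normNull (Q : (ℕ → StrongDual ℝ F) → Prop)
    (hQ : ∀ f, Q f → ∃ C, ∀ n, ‖f n‖ ≤ C) :
    IsClosedSubspace {T : E →L[ℝ] F | ∀ f, Q f → NormNull fun n => adj T (f n)} := by
  have := isClosedSubspace_setOf_tendsto (ι := {f // Q f})
    (fun _ => normSeminorm ℝ (StrongDual ℝ E)) (fun _ => exists_normSeminorm_le)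
    (fun f n => adjCLM (f.1 n)) fun f => (hQ f f.2).imp fun C h n => (norm_adjCLM_le _).trans (h n)
  simp only [Subtype.forall] at this
  exact this

/-- For any family of bounded sequences `f` in `F'`, the operators with `(T' (f n))` weakly null
form a closed subspace. -/
theorem isClosedSubspace_adj_weakNull (Q : (ℕ → StrongDual ℝ F) → Prop)
    (hQ : ∀ f, Q f → ∃ C, ∀ n, ‖f n‖ ≤ C) :
    IsClosedSubspace {T : E →L[ℝ] F | ∀ f, Q f → WeakNull fun n => adj T (f n)} := by
  have := isClosedSubspace_setOf_tendsto (ι := {f // Q f} × StrongDual ℝ (StrongDual ℝ E))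
    (fun i => (normSeminorm ℝ ℝ).comp i.2.toLinearMap)
    (fun i => ⟨‖i.2‖, fun y => i.2.le_opNorm y⟩)
    (fun i n => adjCLM (i.1.1 n))
    fun i => (hQ i.1.1 i.1.2).imp fun C h n => (norm_adjCLM_le _).trans (h n)
  convert this using 1
  ext T
  simp only [Set.mem_ofPred_eq, weakNull_iff, Prod.forall, Subtype.forall]
  exact forall₃_congr fun f hf φ => tendsto_zero_iff_norm_tendsto_zero

/-- For any family of bounded sequences `f` in `F'`, the operators with `(|T' (f n)|)` weak-star
null form a closed subspace. -/
theorem isClosedSubspace_abs_adj_weakStarNull (Q : (ℕ → StrongDual ℝ F) → Prop)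
    (hQ : ∀ f, Q f → ∃ C, ∀ n, ‖f n‖ ≤ C) :
    IsClosedSubspace {T : E →L[ℝ] F | ∀ f, Q f → WeakStarNull fun n => |adj T (f n)|} := by
  have := isClosedSubspace_setOf_tendsto (ι := {f // Q f} × {z : E // 0 ≤ z})
    (fun i => dualAbsSeminorm i.2.1 i.2.2) (fun i => ⟨‖i.2.1‖, dualAbsSeminorm_le _ _⟩)
    (fun i n => adjCLM (i.1.1 n))
    fun i => (hQ i.1.1 i.1.2).imp fun C h n => (norm_adjCLM_le _).trans (h n)
  convert this using 1
  ext T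
  simp only [Set.mem_ofPred_eq, weakStarNull_iff_nonneg, Prod.forall, Subtype.forall]
  rfl

/-- For any family of bounded sequences `x` in `E`, the operators with `(|T (x n)|)` weakly null
form a closed subspace. -/
theorem isClosedSubspace_abs_weakNull [IsOrderedModule ℝ F] (Q : (ℕ → E) → Prop)
    (hQ : ∀ x, Q x → ∃ C, ∀ n, ‖x n‖ ≤ C) :
    IsClosedSubspace {T : E →L[ℝ] F | ∀ x, Q x → WeakNull fun n => |T (x n)|} := by
  have := isClosedSubspace_setOf_tendsto (ι := {x // Q x} × {φ : StrongDual ℝ F // 0 ≤ φ})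
    (fun i => absSeminorm i.2.1 i.2.2) (fun i => ⟨‖i.2.1‖, absSeminorm_le _ _⟩)
    (fun i n => evalCLM (i.1.1 n))
    fun i => (hQ i.1.1 i.1.2).imp fun C h n => (norm_evalCLM_le _).trans (h n)
  convert this using 1
  ext T
  simp only [Set.mem_ofPred_eq, weakNull_abs_iff, Prod.forall, Subtype.forall]
  rfl

theorem isClosedSubspace_PSP : IsClosedSubspace (PSP E F) := by
  have := isClosedSubspace_setOf_tendsto (ι := {x : ℕ → E // (∀ n, 0 ≤ x n) ∧ WeakNull x})
    (fun _ => normSeminorm ℝ F) (fun _ => exists_normSeminorm_le) (fun x n => evalCLM (x.1 n))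
    fun x => x.2.2.bounded.imp fun C h n => (norm_evalCLM_le _).trans (h n)
  simp only [Subtype.forall, and_imp] at this
  exact this

theorem isClosedSubspace_Swl [IsOrderedModule ℝ F] : IsClosedSubspace (Swl E F) :=
  isClosedSubspace_abs_weakNull _ fun _ h => h.bounded

theorem isClosedSubspace_Dswl [IsOrderedModule ℝ F] : IsClosedSubspace (Dswl E F) := by
  simpa only [and_imp] using! isClosedSubspace_abs_weakNull (E := E) (F := F)
    (fun x => DisjointSeq x ∧ WeakNull x) fun _ h => h.2.bounded

variable [CompleteSpace F]

theorem isClosedSubspace_DPSP : IsClosedSubspace (DPSP E F) := by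
  simpa only [and_imp] using! isClosedSubspace_adj_normNull (E := E) (F := F)
    (fun f => (∀ n, 0 ≤ f n) ∧ WeakStarNull f) fun _ h => h.2.bounded

theorem isClosedSubspace_DDSP : IsClosedSubspace (DDSP E F) := by
  simpa only [and_imp] using! isClosedSubspace_adj_normNull (E := E) (F := F)
    (fun f => DisjointSeq f ∧ WeakStarNull f) fun _ h => h.2.bounded

theorem isClosedSubspace_PGP : IsClosedSubspace (PGP E F) := by
  simpa only [and_imp] using! isClosedSubspace_adj_weakNull (E := E) (F := F)
    (fun f => (∀ n, 0 ≤ f n) ∧ WeakStarNull f) fun _ h => h.2.bounded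

theorem isClosedSubspace_DGP : IsClosedSubspace (DGP E F) := by
  simpa only [and_imp] using! isClosedSubspace_adj_weakNull (E := E) (F := F)
    (fun f => DisjointSeq f ∧ WeakStarNull f) fun _ h => h.2.bounded

theorem isClosedSubspace_SwStarl : IsClosedSubspace (SwStarl E F) :=
  isClosedSubspace_abs_adj_weakStarNull _ fun _ h => h.bounded

theorem isClosedSubspace_PropD : IsClosedSubspace (PropD E F) := by
  simpa only [and_imp] using! isClosedSubspace_abs_adj_weakStarNull (E := E) (F := F)
    (fun f => DisjointSeq f ∧ WeakStarNull f) fun _ h => h.2.bounded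

theorem isClosedSubspace_BiSP : IsClosedSubspace (BiSP E F) := by
  have := isClosedSubspace_setOf_tendsto
    (ι := {f : ℕ → StrongDual ℝ F // (∀ n, 0 ≤ f n) ∧ WeakStarNull f} ×
      {x : ℕ → E // DisjointSeq x ∧ WeakNull x})
    (fun _ => normSeminorm ℝ ℝ) (fun _ => exists_normSeminorm_le)
    (fun i n => (i.1.1 n).comp (evalCLM (i.2.1 n))) fun i => by
      obtain ⟨C, hC⟩ := i.1.2.2.bounded
      obtain ⟨D, hD⟩ := i.2.2.2.bounded
      refine ⟨C * D, fun n => (ContinuousLinearMap.opNorm_comp_le _ _).trans ?_⟩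
      exact mul_le_mul (hC n) ((norm_evalCLM_le _).trans (hD n)) (norm_nonneg _)
        ((norm_nonneg _).trans (hC n))
  convert this using 1
  ext T
  simp only [BiSP, Set.mem_ofPred_eq, Prod.forall, Subtype.forall, and_imp]
  constructor
  · intro h f hf hf' x hx hx'
    exact tendsto_zero_iff_norm_tendsto_zero.1 (h f x hf hf' hx hx')
  · intro h f x hf hf' hx hx'
    exact tendsto_zero_iff_norm_tendsto_zero.2 (h f hf hf' x hx hx')

end SequentialClasses

/-! ### Relative compactness through ultrafilters -/

/-- In a regular space, `m '' A` is relatively compact iff `m` converges along every ultrafilter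
that contains `A`. -/
theorem isCompact_closure_image_iff {α Y : Type*} [TopologicalSpace Y] [RegularSpace Y]
    {m : α → Y} {A : Set α} :
    IsCompact (closure (m '' A)) ↔ ∀ U : Ultrafilter α, A ∈ U → ∃ y, Tendsto m U (𝓝 y) := by
  constructor
  · intro h U hU
    obtain ⟨y, -, hy⟩ := h.ultrafilter_le_nhds (U.map m)
      (le_principal_iff.2 (mem_of_superset (image_mem_map hU) subset_closure))
    exact ⟨y, hy⟩
  · intro h
    refine isCompact_iff_ultrafilter_le_nhds.2 fun V hV => ?_
    rw [le_principal_iff] at hV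
    -- The open sets that belong to `V` generate a filter which meets `m '' A`; the limit of a
    -- finer ultrafilter is, by regularity, a limit of `V`.
    have hne : (𝓟 (m '' A) ⊓ (V : Filter Y).bind 𝓝).NeBot := by
      rw [inf_comm, inf_principal_neBot_iff]
      intro s hs
      obtain ⟨y, hys, hy⟩ := V.nonempty_of_mem (inter_mem (mem_bind'.1 hs) hV)
      exact mem_closure_iff_nhds.1 hy s hys
    obtain ⟨G, hG⟩ := exists_ultrafilter_iff.2 hne
    have hGA : m '' A ∈ G := le_principal_iff.1 (hG.trans inf_le_left)
    obtain ⟨y, hy⟩ := h (Ultrafilter.ofComapInfPrincipal hGA)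
      (Ultrafilter.ofComapInfPrincipal_mem hGA)
    have hGy : (G : Filter Y) ≤ 𝓝 y := by
      rw [← Ultrafilter.ofComapInfPrincipal_eq_of_map hGA]
      exact hy
    refine ⟨y, isClosed_closure.mem_of_tendsto (f := id) (b := (G : Filter Y)) hGy
      (mem_of_superset hGA subset_closure), ?_⟩
    refine (closed_nhds_basis y).ge_iff.2 fun C hC => ?_
    by_contra hCV
    have hCV' : Cᶜ ∈ V := Ultrafilter.compl_mem_iff_notMem.2 hCV
    have : Cᶜ ∈ (V : Filter Y).bind 𝓝 := mem_bind'.2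
      (mem_of_superset hCV' fun z hz => hC.2.isOpen_compl.mem_nhds hz)
    exact Ultrafilter.compl_mem_iff_notMem.1 ((hG.trans inf_le_right) this) (hGy hC.1)

/-! ### The classes tested on limited sets -/

section CompactnessClasses

variable {E F : Type*} [NormedAddCommGroup E] [NormedSpace ℝ E]
  [NormedAddCommGroup F] [NormedSpace ℝ F]

/-- The operators that map each member of `𝒜` to a relatively compact set, for a vector topology
that may be weaker than the norm topology of `F`, given by the linear map `e : F → Y`. -/
def compactSubmodule {Y : Type*} [AddCommGroup Y] [Module ℝ Y] [TopologicalSpace Y]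
    [IsTopologicalAddGroup Y] [ContinuousSMul ℝ Y] (e : F →ₗ[ℝ] Y) (𝒜 : Set (Set E)) :
    Submodule ℝ (E →L[ℝ] F) where
  carrier := {T | ∀ A ∈ 𝒜, IsCompact (closure ((fun a => e (T a)) '' A))}
  zero_mem' A _ := isCompact_closure_image_iff.2 fun U _ => ⟨0, by simpa using tendsto_const_nhds⟩
  add_mem' {S T} hS hT A hA := isCompact_closure_image_iff.2 fun U hU => by
    obtain ⟨y, hy⟩ := isCompact_closure_image_iff.1 (hS A hA) U hU
    obtain ⟨z, hz⟩ := isCompact_closure_image_iff.1 (hT A hA) U hU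
    exact ⟨y + z, by simpa using hy.add hz⟩
  smul_mem' c T hT A hA := isCompact_closure_image_iff.2 fun U hU => by
    obtain ⟨y, hy⟩ := isCompact_closure_image_iff.1 (hT A hA) U hU
    exact ⟨c • y, by simpa using hy.const_smul c⟩

/-- Operators close to each other are uniformly close on bounded sets. -/
theorem exists_mem_forall_norm_sub_lt {W : Set (E →L[ℝ] F)} {T : E →L[ℝ] F} (hT : T ∈ closure W)
    {A : Set E} (hA : Bornology.IsBounded A) {ε : ℝ} (hε : 0 < ε) :
    ∃ S ∈ W, ∀ a ∈ A, ‖T a - S a‖ < ε := by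
  obtain ⟨C, hC0, hC⟩ := hA.exists_pos_norm_le
  obtain ⟨S, hS, h⟩ := Metric.mem_closure_iff.1 hT (ε / C) (by positivity)
  refine ⟨S, hS, fun a ha => ?_⟩
  rw [dist_eq_norm, lt_div_iff₀ hC0] at h
  calc ‖T a - S a‖ = ‖(T - S) a‖ := rfl
    _ ≤ ‖T - S‖ * ‖a‖ := (T - S).le_opNorm a
    _ ≤ ‖T - S‖ * C := by gcongr; exact hC a ha
    _ < ε := h

variable [CompleteSpace F]

theorem isClosedSubspace_relCompact {𝒜 : Set (Set E)} (h𝒜 : ∀ A ∈ 𝒜, Bornology.IsBounded A) :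
    IsClosedSubspace {T : E →L[ℝ] F | ∀ A ∈ 𝒜, RelCompact (T '' A)} := by
  refine ⟨compactSubmodule LinearMap.id 𝒜, isClosed_of_closure_subset fun T hT A hA => ?_, rfl⟩
  refine isCompact_closure_image_iff.2 fun U hU => ?_
  -- `T` is Cauchy along `U`, as a uniform limit on `A` of maps with that property.
  refine CompleteSpace.complete (Metric.cauchy_iff.2 ⟨inferInstance, fun ε hε => ?_⟩)
  obtain ⟨S, hS, h⟩ := exists_mem_forall_norm_sub_lt hT (h𝒜 A hA) (half_pos (half_pos hε))
  obtain ⟨y, hy⟩ := isCompact_closure_image_iff.1 (hS A hA) U hU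
  have hy' := hy (Metric.ball_mem_nhds y (half_pos (half_pos hε)))
  have key : ∀ a ∈ A ∩ (fun a => LinearMap.id (R := ℝ) (S a)) ⁻¹' Metric.ball y (ε / 2 / 2),
      dist (T a) y < ε / 2 := fun a ha => by
    have h₁ := h a ha.1
    have h₂ : dist (S a) y < ε / 2 / 2 := ha.2
    rw [← dist_eq_norm] at h₁
    linarith [dist_triangle (T a) (S a) y]
  refine ⟨_, image_mem_map (inter_mem hU hy'), ?_⟩
  rintro _ ⟨a, ha, rfl⟩ _ ⟨b, hb, rfl⟩
  calc dist (T a) (T b) ≤ dist (T a) y + dist (T b) y := dist_triangle_right _ _ y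
    _ < ε := by linarith [key a ha, key b hb]

/-- Weak limits of uniformly close maps are equally close: the norm is weakly lower
semicontinuous. -/
theorem norm_sub_le_of_weak_tendsto {α : Type*} {l : Filter α} [l.NeBot] {m k : α → F} {y z : F}
    (hm : ∀ φ : StrongDual ℝ F, Tendsto (fun a => φ (m a)) l (𝓝 (φ y)))
    (hk : ∀ φ : StrongDual ℝ F, Tendsto (fun a => φ (k a)) l (𝓝 (φ z)))
    {r : ℝ} (hr : 0 ≤ r) (h : ∀ᶠ a in l, ‖m a - k a‖ ≤ r) : ‖y - z‖ ≤ r := by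
  refine NormedSpace.norm_le_dual_bound ℝ _ hr fun φ => ?_
  have lim := ((hm φ).sub (hk φ)).norm
  rw [← map_sub] at lim
  refine le_of_tendsto lim (h.mono fun a ha => ?_)
  rw [← map_sub, mul_comm]
  exact φ.le_opNorm_of_le ha

/-- The limits of weakly compact operators are weakly compact, on a class of bounded sets. Along an
ultrafilter, the approximating operators `S n` have weak limits `y n`; these form a Cauchy sequence,
whose limit is the weak limit of `T`. -/
theorem isClosedSubspace_relWeaklyCompact {𝒜 : Set (Set E)}
    (h𝒜 : ∀ A ∈ 𝒜, Bornology.IsBounded A) :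
    IsClosedSubspace {T : E →L[ℝ] F | ∀ A ∈ 𝒜, RelWeaklyCompact (T '' A)} := by
  refine ⟨compactSubmodule (toWeakSpace ℝ F).toLinearMap 𝒜,
    isClosed_of_closure_subset fun T hT A hA => ?_, ?_⟩
  · refine isCompact_closure_image_iff.2 fun U hU => ?_
    choose S hS hTS using fun n : ℕ => exists_mem_forall_norm_sub_lt hT (h𝒜 A hA)
      (ε := (1 / 2) ^ n) (by positivity)
    have lim : ∀ n, ∃ y : F, ∀ φ : StrongDual ℝ F,
        Tendsto (fun a => φ (S n a)) U (𝓝 (φ y)) := fun n => by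
      obtain ⟨y, hy⟩ := isCompact_closure_image_iff.1 (hS n A hA) U hU
      exact ⟨(toWeakSpace ℝ F).symm y, tendsto_toWeakSpace_iff.1 (by simpa using hy)⟩
    choose y hy using lim
    have hdist : ∀ n, dist (y n) (y (n + 1)) ≤ 2 * (1 / 2) ^ n := fun n => by
      rw [dist_eq_norm]
      refine norm_sub_le_of_weak_tendsto (hy n) (hy (n + 1)) (by positivity)
        (eventually_of_mem hU fun a ha => ?_)
      have h₁ := hTS n a ha
      have h₂ := hTS (n + 1) a ha
      have h₃ : ((1 : ℝ) / 2) ^ (n + 1) ≤ (1 / 2) ^ n :=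
        pow_le_pow_of_le_one (by norm_num) (by norm_num) n.le_succ
      have h₄ := norm_sub_le_norm_sub_add_norm_sub (S n a) (T a) (S (n + 1) a)
      rw [norm_sub_rev (S n a) (T a)] at h₄
      linarith
    obtain ⟨z, hz⟩ := cauchySeq_tendsto_of_complete
      (cauchySeq_of_le_geometric (1 / 2) 2 (by norm_num) hdist)
    refine ⟨toWeakSpace ℝ F z, tendsto_toWeakSpace_iff.2 fun φ => ?_⟩
    rw [Metric.tendsto_nhds]
    intro ε hε
    have hφ : Tendsto (fun n => ‖φ‖ * (1 / 2) ^ n + dist (φ (y n)) (φ z)) atTop (𝓝 0) := by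
      have h₁ := (tendsto_pow_atTop_nhds_zero_of_lt_one (r := (1 / 2 : ℝ)) (by norm_num)
        (by norm_num)).const_mul ‖φ‖
      have h₂ := tendsto_iff_dist_tendsto_zero.1 ((φ.continuous.tendsto z).comp hz)
      simpa using h₁.add h₂
    obtain ⟨n, hn⟩ := (hφ.eventually_lt_const hε).exists
    have hn' : dist (φ (y n)) (φ z) < ε - ‖φ‖ * (1 / 2) ^ n := by linarith
    have hev : ∀ᶠ a in (U : Filter E), dist (φ (S n a)) (φ z) < ε - ‖φ‖ * (1 / 2) ^ n :=
      ((hy n φ).dist tendsto_const_nhds).eventually_lt_const hn'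
    filter_upwards [hev, hU] with a ha haA
    have h₁ : dist (φ (T a)) (φ (S n a)) ≤ ‖φ‖ * (1 / 2) ^ n := by
      rw [dist_eq_norm, ← map_sub]
      exact φ.le_opNorm_of_le (hTS n a haA).le
    exact (dist_triangle (φ (T a)) (φ (S n a)) (φ z)).trans_lt (by linarith)
  · ext T
    simp only [RelWeaklyCompact, Set.image_image]
    rfl

end CompactnessClasses

section LimitedClasses

variable {E F : Type*}
  [NormedAddCommGroup E] [NormedSpace ℝ E] [Lattice E] [IsOrderedAddMonoid E] [HasSolidNorm E]
  [NormedAddCommGroup F] [NormedSpace ℝ F] [Lattice F] [IsOrderedAddMonoid F] [HasSolidNorm F]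
  [CompleteSpace F]

theorem isClosedSubspace_GPP : IsClosedSubspace (GPP E F) :=
  isClosedSubspace_relCompact (𝒜 := {A | IsLimited A}) fun _ h => h.1

theorem isClosedSubspace_SGPP : IsClosedSubspace (SGPP E F) :=
  isClosedSubspace_relCompact (𝒜 := {A | IsAlmostLimited A}) fun _ h => h.1

theorem isClosedSubspace_BDP : IsClosedSubspace (BDP E F) :=
  isClosedSubspace_relWeaklyCompact (𝒜 := {A | IsLimited A}) fun _ h => h.1

theorem isClosedSubspace_SBDP : IsClosedSubspace (SBDP E F) :=
  isClosedSubspace_relWeaklyCompact (𝒜 := {A | IsAlmostLimited A}) fun _ h => h.1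

/-- For a closed subspace `P`, the regularly `P`-operators form a Banach space. -/
theorem IsClosedSubspace.isBanachUnder [IsOrderedModule ℝ F] {P : Set (E →L[ℝ] F)}
    (hP : IsClosedSubspace P) : IsBanachUnder (regularly P) (envelopingNorm P) := by
  obtain ⟨W, hW, rfl⟩ := hP
  exact isBanachUnder_regularly W hW

end LimitedClasses

end AffiliatedOperators

open AffiliatedOperators in
theorem theorem2p1 (E F : Type*)
    [NormedAddCommGroup E] [NormedSpace ℝ E] [CompleteSpace E]
    [Lattice E] [IsOrderedAddMonoid E] [IsOrderedModule ℝ E] [HasSolidNorm E]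
    [NormedAddCommGroup F] [NormedSpace ℝ F] [CompleteSpace F]
    [Lattice F] [IsOrderedAddMonoid F] [IsOrderedModule ℝ F] [HasSolidNorm F] :
    IsBanachUnder (regularly (PSP E F)) (envelopingNorm (PSP E F)) ∧
    IsBanachUnder (regularly (DPSP E F)) (envelopingNorm (DPSP E F)) ∧
    IsBanachUnder (regularly (DDSP E F)) (envelopingNorm (DDSP E F)) ∧
    IsBanachUnder (regularly (PGP E F)) (envelopingNorm (PGP E F)) ∧
    IsBanachUnder (regularly (DGP E F)) (envelopingNorm (DGP E F)) ∧
    IsBanachUnder (regularly (Swl E F)) (envelopingNorm (Swl E F)) ∧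
    IsBanachUnder (regularly (Dswl E F)) (envelopingNorm (Dswl E F)) ∧
    IsBanachUnder (regularly (SwStarl E F)) (envelopingNorm (SwStarl E F)) ∧
    IsBanachUnder (regularly (PropD E F)) (envelopingNorm (PropD E F)) ∧
    IsBanachUnder (regularly (BiSP E F)) (envelopingNorm (BiSP E F)) ∧
    IsBanachUnder (regularly (GPP E F)) (envelopingNorm (GPP E F)) ∧
    IsBanachUnder (regularly (SGPP E F)) (envelopingNorm (SGPP E F)) ∧
    IsBanachUnder (regularly (BDP E F)) (envelopingNorm (BDP E F)) ∧
    IsBanachUnder (regularly (SBDP E F)) (envelopingNorm (SBDP E F)) := by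
  exact ⟨isClosedSubspace_PSP.isBanachUnder,
    isClosedSubspace_DPSP.isBanachUnder,
    isClosedSubspace_DDSP.isBanachUnder,
    isClosedSubspace_PGP.isBanachUnder,
    isClosedSubspace_DGP.isBanachUnder,
    isClosedSubspace_Swl.isBanachUnder,
    isClosedSubspace_Dswl.isBanachUnder,
    isClosedSubspace_SwStarl.isBanachUnder,
    isClosedSubspace_PropD.isBanachUnder,
    isClosedSubspace_BiSP.isBanachUnder,
    isClosedSubspace_GPP.isBanachUnder,
    isClosedSubspace_SGPP.isBanachUnder,
    isClosedSubspace_BDP.isBanachUnder,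
    isClosedSubspace_SBDP.isBanachUnder⟩
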